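/- An edge-signed graph $G=(V,E^+,E^-)$ consists of a finite set $V=V(G)$ of vertices and two disjoint sets $E^+,E^-$ of $2$-subsets of $V$; its underlying graph is $(V,E^+\cup E^-)$, and $G$ is connected if its underlying graph is. Its adjacency matrix $A(G)$ is the symmetric matrix indexed by $V$ with $A(G)_{uw}=1$ if $\{u,w\}\in E^+$, $A(G)_{uw}=-1$ if $\{u,w\}\in E^-$, and $A(G)_{uw}=0$ otherwise. For $v\in V$, let $\hat A(G,v)$ be the matrix obtained from $A(G)$ by putting $-1$ in the diagonal position corresponding to $v$. Write $\lambda_1(M)$ for the smallest eigenvalue of a real symmetric matrix $M$, and $\lambda_1(G)=\lambda_1(A(G))$. An end-edge of a tree is an edge one of whose end-vertices has valency $1$. **Theorem.** Let $G$ be a connected edge-signed graph with $\lambda_1(G)>-2$, and let $v\in V(G)$. Then $\lambda_1(G)>\lambda_1(\hat A(G,v))$. Furthermore, $\lambda_1(\hat A(G,v))>-2$ if and only if the underlying graph of $G$ is (isomorphic to) the line graph of a finite tree $T$ in such a way that $v$ corresponds to an end-edge of $T$. Otherwise, $\lambda_1(\hat A(G,v))\leqslant-2$. -/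

import Mathlib

/-- An edge-signed graph with vertex set `V`: a set of `(+)`-edges and a set of `(-)`-edges
(both consisting of 2-subsets of `V`), with no pair being an edge of both signs. -/
structure EdgeSignedGraph (V : Type*) where
  /-- the graph formed by the `(+)`-edges -/
  pos : SimpleGraph V
  /-- the graph formed by the `(-)`-edges -/
  neg : SimpleGraph V
  disjoint_edgeSet : Disjoint pos.edgeSet neg.edgeSet

namespace EdgeSignedGraph

variable {V : Type*}

/-- The underlying (unsigned) graph, with edge set `E⁺ ∪ E⁻`. -/
def underlying (G : EdgeSignedGraph V) : SimpleGraph V := G.pos ⊔ G.neg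

open Classical in
/-- The signed adjacency matrix. -/
noncomputable def adjMatrix (G : EdgeSignedGraph V) : Matrix V V ℝ :=
  Matrix.of fun u w => if G.pos.Adj u w then 1 else if G.neg.Adj u w then -1 else 0

open Classical in
/-- The modified adjacency matrix `Â(G, v)`: the adjacency matrix with the diagonal entry at `v`
replaced by `-1`. -/
noncomputable def modAdjMatrix (G : EdgeSignedGraph V) (v : V) : Matrix V V ℝ :=
  Matrix.of fun u w => if u = v ∧ w = v then -1 else G.adjMatrix u w

theorem adjMatrix_isHermitian (G : EdgeSignedGraph V) : G.adjMatrix.IsHermitian := by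
  ext u w
  have h₁ := G.pos.adj_comm u w
  have h₂ := G.neg.adj_comm u w
  by_cases hp : G.pos.Adj u w <;> by_cases hn : G.neg.Adj u w <;> simp_all [adjMatrix]

theorem modAdjMatrix_isHermitian (G : EdgeSignedGraph V) (v : V) :
    (G.modAdjMatrix v).IsHermitian := by
  ext u w
  have h := G.adjMatrix_isHermitian.apply u w
  by_cases hu : u = v <;> by_cases hw : w = v <;> simp_all [modAdjMatrix]

end EdgeSignedGraph

/-- The smallest (real) eigenvalue `λ₁(A)` of a square matrix. For a real symmetric matrix of
positive size this is a genuine minimum, see `isLeast_smallestEigenvalue`. -/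
noncomputable def smallestEigenvalue {V : Type*} [Fintype V] (A : Matrix V V ℝ) : ℝ :=
  sInf {μ : ℝ | Module.End.HasEigenvalue A.mulVecLin μ}

theorem isLeast_smallestEigenvalue {V : Type*} [Fintype V] [Nonempty V] {A : Matrix V V ℝ}
    (hA : A.IsHermitian) :
    IsLeast {μ : ℝ | Module.End.HasEigenvalue A.mulVecLin μ} (smallestEigenvalue A) := by
  classical
  have h : {μ : ℝ | Module.End.HasEigenvalue A.mulVecLin μ} = Set.range hA.eigenvalues := by
    rw [← hA.spectrum_real_eq_range_eigenvalues, ← Matrix.spectrum_toLin']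
    ext μ
    exact Module.End.hasEigenvalue_iff_mem_spectrum
  unfold smallestEigenvalue
  rw [h]
  exact ⟨(Set.range_nonempty _).csInf_mem (Set.finite_range _),
    fun x hx => csInf_le (Set.finite_range _).bddBelow hx⟩

/-- An end-edge of a graph `T`: an edge one of whose end-vertices has valency `1`. -/
def SimpleGraph.IsEndEdge {W : Type*} (T : SimpleGraph W) (e : T.edgeSet) : Prop :=
  ∃ w ∈ (e : Sym2 W), (T.neighborSet w).ncard = 1

/-- `H` is (isomorphic to) the line graph of some finite tree `T`, in such a way that the
vertex `v` of `H` corresponds to an end-edge of `T`. -/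
def SimpleGraph.IsTreeLineGraphAtEndEdge {V : Type*} (H : SimpleGraph V) (v : V) : Prop :=
  ∃ (W : Type) (_ : Finite W) (T : SimpleGraph W),
    T.IsTree ∧ ∃ φ : H ≃g T.lineGraph, T.IsEndEdge (φ v)

/-!
Let `T` be a tree with line graph `G`. All triangles of `G` are positive because `λ₁(G) > -2`, so
`A(G) + 2I = Nᵀ N` for a signed incidence matrix `N` of `T`; since `T` is a tree, the rows of `N`
can be rescaled by signs until `N Nᵀ` is the Laplacian of `T`. If the edge `v` ends in a vertex
`r` of valency `1`, then deleting the row `r` of `N` gives `Â(G, v) + 2I` in place of `A(G) + 2I`,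
and the Laplacian grounded at `r` in place of the Laplacian. The grounded Laplacian is positive
definite, and its smallest eigenvalue is less than every nonzero eigenvalue of the Laplacian.

Conversely, `λ₁(Â(G, v)) > -2` makes `Â(G, v) + 2I` a Gram matrix of linearly independent vectors.
Adding a unit vector `e` in a new direction to the one indexed by `v` gives vectors with Gram
matrix `A(G) + 2I`; together with `e` they span an integral lattice. Since `G` is connected and
`e` is not orthogonal to the vector of `v`, every Gram vector is the sum of two orthogonal unit
vectors of this lattice, hence corresponds to a pair of members of an orthonormal family. These
pairs are the edges of a connected graph with at least one more vertex than edges, which is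
therefore a tree, and `v` is the only edge at `e`.
-/

section Spectrum

open Matrix

variable {V : Type*} [Fintype V]

theorem hasEigenvalue_mulVecLin_iff {R : Type*} [CommRing R] {A : Matrix V V R} {μ : R} :
    Module.End.HasEigenvalue A.mulVecLin μ ↔ ∃ x ≠ 0, A *ᵥ x = μ • x := by
  simp only [Module.End.hasEigenvalue_iff, Submodule.ne_bot_iff, Module.End.mem_eigenspace_iff,
    mulVecLin_apply, and_comm]

theorem hasEigenvalue_mulVecLin_iff_isRoot_charpoly {K : Type*} [Field K] [DecidableEq V]
    {A : Matrix V V K} {μ : K} :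
    Module.End.HasEigenvalue A.mulVecLin μ ↔ A.charpoly.IsRoot μ := by
  rw [Module.End.hasEigenvalue_iff_isRoot_charpoly, charpoly_mulVecLin]

theorem hasEigenvalue_mul_comm {W K : Type*} [Fintype W] [Field K] {A : Matrix V W K}
    {B : Matrix W V K} {μ : K} (hμ : μ ≠ 0) (h : Module.End.HasEigenvalue (A * B).mulVecLin μ) :
    Module.End.HasEigenvalue (B * A).mulVecLin μ := by
  obtain ⟨x, hx, hABx⟩ := hasEigenvalue_mulVecLin_iff.1 h
  refine hasEigenvalue_mulVecLin_iff.2 ⟨B *ᵥ x, fun hBx => ?_, ?_⟩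
  · rw [← mulVec_mulVec, hBx, mulVec_zero, eq_comm, smul_eq_zero] at hABx
    exact hABx.elim hμ hx
  · rw [← mulVec_mulVec, mulVec_mulVec x, hABx, mulVec_smul]

theorem smallestEigenvalue_mul_comm {W : Type*} [Fintype W]
    (hcard : Fintype.card V = Fintype.card W) (A : Matrix V W ℝ) (B : Matrix W V ℝ) :
    smallestEigenvalue (A * B) = smallestEigenvalue (B * A) := by
  classical
  have hchar : (A * B).charpoly = (B * A).charpoly :=
    mul_left_cancel₀ (pow_ne_zero (Fintype.card V) Polynomial.X_ne_zero)
      (by simpa only [hcard] using charpoly_mul_comm' A B)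
  simp only [smallestEigenvalue, hasEigenvalue_mulVecLin_iff_isRoot_charpoly, hchar]

theorem hasEigenvalue_add_smul_one_iff {R : Type*} [CommRing R] [DecidableEq V]
    {A : Matrix V V R} {c μ : R} :
    Module.End.HasEigenvalue (A + c • 1).mulVecLin μ ↔
      Module.End.HasEigenvalue A.mulVecLin (μ - c) := by
  simp only [hasEigenvalue_mulVecLin_iff, add_mulVec, smul_mulVec, one_mulVec, sub_smul,
    eq_sub_iff_add_eq]

variable [Nonempty V] {A : Matrix V V ℝ}

theorem smallestEigenvalue_add_smul_one [DecidableEq V] (hA : A.IsHermitian) (c : ℝ) :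
    smallestEigenvalue (A + c • 1) = smallestEigenvalue A + c := by
  refine IsLeast.csInf_eq ⟨?_, fun μ hμ => ?_⟩
  · rw [Set.mem_ofPred_eq, hasEigenvalue_add_smul_one_iff, add_sub_cancel_right]
    exact (isLeast_smallestEigenvalue hA).1
  · exact le_sub_iff_add_le.1
      ((isLeast_smallestEigenvalue hA).2 (hasEigenvalue_add_smul_one_iff.1 hμ))

theorem isLeast_range_eigenvalues [DecidableEq V] (hA : A.IsHermitian) :
    IsLeast (Set.range hA.eigenvalues) (smallestEigenvalue A) := by
  have h := isLeast_smallestEigenvalue hA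
  simp only [← toLin'_apply', Module.End.hasEigenvalue_iff_mem_spectrum, spectrum_toLin'] at h
  rwa [← hA.spectrum_real_eq_range_eigenvalues]

theorem posDef_iff_smallestEigenvalue_pos (hA : A.IsHermitian) :
    A.PosDef ↔ 0 < smallestEigenvalue A := by
  classical
  rw [hA.posDef_iff_eigenvalues_pos, (isLeast_range_eigenvalues hA).lt_iff, Set.forall_mem_range]

theorem posDef_add_smul_one_iff [DecidableEq V] (hA : A.IsHermitian) {c : ℝ} :
    (A + c • 1).PosDef ↔ -c < smallestEigenvalue A := by
  rw [posDef_iff_smallestEigenvalue_pos (hA.add (isHermitian_one.smul (.all _))),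
    smallestEigenvalue_add_smul_one hA, neg_lt_iff_pos_add]

theorem posSemidef_iff_smallestEigenvalue_nonneg (hA : A.IsHermitian) :
    A.PosSemidef ↔ 0 ≤ smallestEigenvalue A := by
  classical
  rw [hA.posSemidef_iff_eigenvalues_nonneg, Pi.le_def,
    le_isGLB_iff (isLeast_range_eigenvalues hA).isGLB, mem_lowerBounds, Set.forall_mem_range]
  rfl

theorem posSemidef_sub_smallestEigenvalue_smul_one [DecidableEq V] (hA : A.IsHermitian) :
    (A - smallestEigenvalue A • 1).PosSemidef := by
  rw [sub_eq_add_neg, ← neg_smul, posSemidef_iff_smallestEigenvalue_nonneg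
    (hA.add (isHermitian_one.smul (.all _))), smallestEigenvalue_add_smul_one hA, add_neg_cancel]

theorem smallestEigenvalue_mul_le (hA : A.IsHermitian) (x : V → ℝ) :
    smallestEigenvalue A * (x ⬝ᵥ x) ≤ x ⬝ᵥ A *ᵥ x := by
  classical
  have h := (posSemidef_sub_smallestEigenvalue_smul_one hA).dotProduct_mulVec_nonneg x
  simpa [sub_mulVec, smul_mulVec, dotProduct_sub] using h

theorem mulVec_eq_smallestEigenvalue_smul (hA : A.IsHermitian) {x : V → ℝ}
    (hx : x ⬝ᵥ A *ᵥ x ≤ smallestEigenvalue A * (x ⬝ᵥ x)) :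
    A *ᵥ x = smallestEigenvalue A • x := by
  classical
  have h := (posSemidef_sub_smallestEigenvalue_smul_one hA).dotProduct_mulVec_zero_iff x
  simp only [star_trivial, sub_mulVec, smul_mulVec, one_mulVec, dotProduct_sub, dotProduct_smul,
    smul_eq_mul, sub_eq_zero] at h
  exact h.1 (hx.antisymm (smallestEigenvalue_mul_le hA x))

end Spectrum

section Laplacian

open Matrix

theorem sum_sub_sq_of_sum_eq_zero {R W : Type*} [CommRing R] [Fintype W] {y : W → R}
    (hy : ∑ i, y i = 0) (c : R) :
    ∑ i, (y i - c) ^ 2 = y ⬝ᵥ y + Fintype.card W * c ^ 2 := by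
  simp [sub_sq, Finset.sum_add_distrib, Finset.sum_sub_distrib, ← Finset.sum_mul,
    ← Finset.mul_sum, hy, dotProduct, ← sq]

variable {W : Type*} [Fintype W] [DecidableEq W] (T : SimpleGraph W) [DecidableRel T.Adj] (r : W)

/-- The grounded Laplacian of `T` at `r`: the Laplacian matrix with the row and the column of `r`
deleted. -/
def groundedLapMatrix : Matrix {i // i ≠ r} {i // i ≠ r} ℝ :=
  (T.lapMatrix ℝ).submatrix (↑) (↑)

variable {T r}

theorem isHermitian_groundedLapMatrix : (groundedLapMatrix T r).IsHermitian :=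
  (T.isHermitian_lapMatrix ℝ).submatrix _

theorem sum_subtype_ne_of_eq_zero {M : Type*} [AddCommMonoid M] {f : W → M} (hf : f r = 0) :
    ∑ i : {i // i ≠ r}, f i = ∑ i, f i := by
  rw [Fintype.sum_eq_add_sum_subtype_ne f r, hf, zero_add]

theorem groundedLapMatrix_mulVec_apply {x : W → ℝ} (hx : x r = 0) (i : {i // i ≠ r}) :
    (groundedLapMatrix T r *ᵥ fun j => x j) i = (T.lapMatrix ℝ *ᵥ x) i :=
  sum_subtype_ne_of_eq_zero (f := fun j => T.lapMatrix ℝ i j * x j) (by rw [hx, mul_zero])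

theorem dotProduct_groundedLapMatrix_mulVec {x : W → ℝ} (hx : x r = 0) :
    (fun i : {i // i ≠ r} => x i) ⬝ᵥ groundedLapMatrix T r *ᵥ (fun i => x i) =
      x ⬝ᵥ T.lapMatrix ℝ *ᵥ x := by
  simp only [dotProduct, groundedLapMatrix_mulVec_apply hx]
  exact sum_subtype_ne_of_eq_zero (f := fun i => x i * (T.lapMatrix ℝ *ᵥ x) i)
    (by rw [hx, zero_mul])

theorem dotProduct_lapMatrix_mulVec (x : W → ℝ) :
    x ⬝ᵥ T.lapMatrix ℝ *ᵥ x = (∑ i, ∑ j, if T.Adj i j then (x i - x j) ^ 2 else 0) / 2 := by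
  rw [← toLinearMap₂'_apply', T.lapMatrix_toLinearMap₂' ℝ]

theorem abs_dotProduct_lapMatrix_mulVec_abs_le (x : W → ℝ) :
    |x| ⬝ᵥ T.lapMatrix ℝ *ᵥ |x| ≤ x ⬝ᵥ T.lapMatrix ℝ *ᵥ x := by
  simp only [dotProduct_lapMatrix_mulVec, Pi.abs_apply]
  gcongr with i _ j _
  split_ifs
  · exact sq_le_sq.2 (abs_abs_sub_abs_le (x i) (x j))
  · exact le_rfl

theorem posDef_groundedLapMatrix (hT : T.Connected) : (groundedLapMatrix T r).PosDef := by
  refine .of_dotProduct_mulVec_pos isHermitian_groundedLapMatrix fun x hx => ?_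
  obtain ⟨z, hzr, rfl⟩ : ∃ z : W → ℝ, z r = 0 ∧ x = fun i : {i // i ≠ r} => z i :=
    ⟨fun i => if hi : i ≠ r then x ⟨i, hi⟩ else 0, by simp, funext fun i => by simp [i.2]⟩
  rw [star_trivial, dotProduct_groundedLapMatrix_mulVec hzr]
  refine ((T.posSemidef_lapMatrix ℝ).dotProduct_mulVec_nonneg z).lt_of_ne fun hz => hx ?_
  rw [star_trivial, eq_comm, ← toLinearMap₂'_apply',
    T.lapMatrix_toLinearMap₂'_apply'_eq_zero_iff_forall_reachable] at hz
  exact funext fun i => (hz i r (hT.preconnected i r)).trans hzr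

/- The vector `|x|` attains the minimal Rayleigh quotient too, hence is an eigenvector; its
eigenvalue equation at the zero `c` says that the values of `|x|` at the neighbours of `c` sum
to `0`. -/
theorem eq_zero_of_adj_of_dotProduct_lapMatrix_mulVec_le {x : W → ℝ} (hxr : x r = 0)
    (hx : x ⬝ᵥ T.lapMatrix ℝ *ᵥ x ≤ smallestEigenvalue (groundedLapMatrix T r) * (x ⬝ᵥ x))
    {c d : W} (hcr : c ≠ r) (hc : x c = 0) (hcd : T.Adj c d) : x d = 0 := by
  have : Nonempty {i // i ≠ r} := ⟨⟨c, hcr⟩⟩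
  have habs : |x| r = 0 := by simp [hxr]
  have hnorm : (fun i : {i // i ≠ r} => |x| i) ⬝ᵥ (fun i => |x| i) = x ⬝ᵥ x := by
    simp only [dotProduct, Pi.abs_apply, abs_mul_abs_self]
    exact sum_subtype_ne_of_eq_zero (f := fun i => x i * x i) (by rw [hxr, zero_mul])
  have heigen := mulVec_eq_smallestEigenvalue_smul (isHermitian_groundedLapMatrix (T := T))
    (x := fun i : {i // i ≠ r} => |x| i) <| by
      rw [dotProduct_groundedLapMatrix_mulVec habs, hnorm]
      exact (abs_dotProduct_lapMatrix_mulVec_abs_le x).trans hx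
  have hsum : ∑ j ∈ T.neighborFinset c, |x j| = 0 := by
    have h := congrFun heigen ⟨c, hcr⟩
    rw [groundedLapMatrix_mulVec_apply habs, T.lapMatrix_mulVec_apply] at h
    simpa [hc] using h
  simpa using (Finset.sum_eq_zero_iff_of_nonneg fun _ _ => abs_nonneg _).1 hsum d
    ((T.mem_neighborFinset c d).2 hcd)

theorem sum_eq_zero_of_lapMatrix_mulVec_eq_smul {μ : ℝ} (hμ : μ ≠ 0) {y : W → ℝ}
    (hy : T.lapMatrix ℝ *ᵥ y = μ • y) : ∑ i, y i = 0 := by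
  have h : μ * ∑ i, y i = 0 := calc
    μ * ∑ i, y i = (fun _ => 1) ⬝ᵥ T.lapMatrix ℝ *ᵥ y := by
      rw [hy, dotProduct_smul, smul_eq_mul]; simp [dotProduct]
    _ = (T.lapMatrix ℝ *ᵥ fun _ => 1) ⬝ᵥ y := by
      rw [dotProduct_mulVec, ← mulVec_transpose, T.isSymm_lapMatrix ℝ]
    _ = 0 := by rw [T.lapMatrix_mulVec_const_eq_zero, zero_dotProduct]
  exact (mul_eq_zero.1 h).resolve_left hμ

theorem smallestEigenvalue_groundedLapMatrix_mul_sum_sub_sq_le [Nonempty {i // i ≠ r}]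
    (x : W → ℝ) :
    smallestEigenvalue (groundedLapMatrix T r) * ∑ i, (x i - x r) ^ 2 ≤
      x ⬝ᵥ T.lapMatrix ℝ *ᵥ x := by
  have hshift : x ⬝ᵥ T.lapMatrix ℝ *ᵥ x =
      (fun i => x i - x r) ⬝ᵥ T.lapMatrix ℝ *ᵥ fun i => x i - x r := by
    simp only [dotProduct_lapMatrix_mulVec, sub_sub_sub_cancel_right]
  rw [hshift, ← dotProduct_groundedLapMatrix_mulVec (r := r) (sub_self _),
    ← sum_subtype_ne_of_eq_zero (r := r) (by simp)]
  simpa only [dotProduct, ← sq] using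
    smallestEigenvalue_mul_le isHermitian_groundedLapMatrix fun i : {i // i ≠ r} => x i - x r

theorem pos_of_hasEigenvalue_lapMatrix {μ : ℝ} (hμ : μ ≠ 0)
    (h : Module.End.HasEigenvalue (T.lapMatrix ℝ).mulVecLin μ) : 0 < μ := by
  obtain ⟨y, hy0, hy⟩ := hasEigenvalue_mulVecLin_iff.1 h
  have hquad := (T.posSemidef_lapMatrix ℝ).dotProduct_mulVec_nonneg y
  rw [hy, dotProduct_smul, smul_eq_mul] at hquad
  exact hμ.symm.lt_of_le (nonneg_of_mul_nonneg_left hquad (dotProduct_star_self_pos_iff.2 hy0))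

theorem apply_eq_zero_of_le_smallestEigenvalue_groundedLapMatrix [Nonempty {i // i ≠ r}] {μ : ℝ}
    (hμ : 0 < μ) {y : W → ℝ} (hy : T.lapMatrix ℝ *ᵥ y = μ • y)
    (hle : μ ≤ smallestEigenvalue (groundedLapMatrix T r)) : y r = 0 := by
  have : Nonempty W := ⟨r⟩
  have hbound : μ * (y ⬝ᵥ y + Fintype.card W * y r ^ 2) ≤ μ * (y ⬝ᵥ y) := calc
    μ * (y ⬝ᵥ y + Fintype.card W * y r ^ 2) = μ * ∑ i, (y i - y r) ^ 2 := by
      rw [sum_sub_sq_of_sum_eq_zero (sum_eq_zero_of_lapMatrix_mulVec_eq_smul hμ.ne' hy)]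
    _ ≤ smallestEigenvalue (groundedLapMatrix T r) * ∑ i, (y i - y r) ^ 2 := by gcongr
    _ ≤ y ⬝ᵥ T.lapMatrix ℝ *ᵥ y := smallestEigenvalue_groundedLapMatrix_mul_sum_sub_sq_le y
    _ = μ * (y ⬝ᵥ y) := by rw [hy, dotProduct_smul, smul_eq_mul]
  have hyr : Fintype.card W * y r ^ 2 ≤ 0 := by linarith [le_of_mul_le_mul_left hbound hμ]
  exact (sq_nonpos_iff _).1 (nonpos_of_mul_nonpos_right hyr (by exact_mod_cast Fintype.card_pos))

/- If the inequality failed, a `μ`-eigenvector `y` would vanish at `r`, hence at the only neighbour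
of `r`, and its zeros would spread along the edges of `T`. -/
theorem smallestEigenvalue_groundedLapMatrix_lt (hT : T.Connected)
    (hr : (T.neighborSet r).ncard = 1) {μ : ℝ} (hμ : μ ≠ 0)
    (h : Module.End.HasEigenvalue (T.lapMatrix ℝ).mulVecLin μ) :
    smallestEigenvalue (groundedLapMatrix T r) < μ := by
  obtain ⟨s, hs⟩ := Set.ncard_eq_one.1 hr
  have hadj : ∀ d, T.Adj r d ↔ d = s := fun d => by
    rw [← T.mem_neighborSet, hs, Set.mem_singleton_iff]
  have : Nonempty {i // i ≠ r} := ⟨⟨s, ((hadj s).2 rfl).ne'⟩⟩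
  obtain ⟨y, hy0, hy⟩ := hasEigenvalue_mulVecLin_iff.1 h
  by_contra! hle
  have hyr := apply_eq_zero_of_le_smallestEigenvalue_groundedLapMatrix
    (pos_of_hasEigenvalue_lapMatrix hμ h) hy hle
  have hys : y s = 0 := by
    have hnbr : T.neighborFinset r = {s} := by
      ext d
      rw [SimpleGraph.mem_neighborFinset, hadj, Finset.mem_singleton]
    simpa [T.lapMatrix_mulVec_apply, hnbr, hyr] using congrFun hy r
  have hquad : y ⬝ᵥ T.lapMatrix ℝ *ᵥ y ≤
      smallestEigenvalue (groundedLapMatrix T r) * (y ⬝ᵥ y) := by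
    rw [hy, dotProduct_smul, smul_eq_mul]
    exact mul_le_mul_of_nonneg_right hle (dotProduct_star_self_nonneg y)
  refine hy0 (funext fun i => ?_)
  by_contra hi
  obtain ⟨p⟩ := hT.preconnected r i
  obtain ⟨⟨⟨c, d⟩, hcd⟩, -, hc, hd⟩ := p.exists_boundary_dart {i | y i = 0} hyr hi
  refine hd (?_ : y d = 0)
  rcases eq_or_ne c r with rfl | hcr
  · rwa [(hadj d).1 hcd]
  · exact eq_zero_of_adj_of_dotProduct_lapMatrix_mulVec_le hyr hquad hcr hc hcd

end Laplacian

theorem eq_of_mem_of_ncard_neighborSet_eq_one {W : Type*} {T : SimpleGraph W} {r : W}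
    (hr : (T.neighborSet r).ncard = 1) {e f : T.edgeSet} (he : r ∈ (e : Sym2 W))
    (hf : r ∈ (f : Sym2 W)) : e = f := by
  obtain ⟨x, hx⟩ := Set.ncard_eq_one.1 hr
  have huniq : ∀ {g : T.edgeSet}, r ∈ (g : Sym2 W) → (g : Sym2 W) = s(r, x) := fun {g} hg => by
    obtain ⟨y, hy⟩ := hg
    have hyx : y ∈ T.neighborSet r := T.mem_edgeSet.1 (hy ▸ g.2)
    rw [hx, Set.mem_singleton_iff] at hyx
    rw [hy, hyx]
  exact Subtype.ext ((huniq he).trans (huniq hf).symm)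

section SignedIncidence

open Matrix

variable {V W : Type*} [DecidableEq W] {T : SimpleGraph W} [DecidableRel T.Adj]

/-- `N` is a signed incidence matrix of `T` with columns indexed by `V` through `φ`: up to signs,
its entries are those of the incidence matrix of `T`. -/
def IsSignedIncMatrix (φ : V ≃ T.edgeSet) (N : Matrix W V ℝ) : Prop :=
  ∀ i u, |N i u| = T.incMatrix ℝ i (φ u)

/-- A signed incidence matrix is oriented if the two nonzero entries of each of its columns
cancel. -/
structure IsOrientedIncMatrix [Fintype W] (φ : V ≃ T.edgeSet) (N : Matrix W V ℝ) : Prop where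
  isSigned : IsSignedIncMatrix φ N
  sum_eq_zero : ∀ u, ∑ i, N i u = 0

namespace IsSignedIncMatrix

variable {φ : V ≃ T.edgeSet} {N : Matrix W V ℝ}

theorem apply_eq_zero_iff (hN : IsSignedIncMatrix φ N) {i : W} {u : V} :
    N i u = 0 ↔ i ∉ (φ u : Sym2 W) := by
  rw [← abs_eq_zero, hN i u, T.incMatrix_apply_eq_zero_iff]
  simp [SimpleGraph.incidenceSet, (φ u).2]

theorem mul_self_apply (hN : IsSignedIncMatrix φ N) (i : W) (u : V) :
    N i u * N i u = T.incMatrix ℝ i (φ u) := by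
  rw [← abs_mul_abs_self, hN i u, T.incMatrix_apply_mul_incMatrix_apply, Set.inter_self,
    T.incMatrix_apply]

theorem sum_apply_mul [Fintype W] (hN : IsSignedIncMatrix φ N) {u : V} {a b : W} (hab : a ≠ b)
    (hu : (φ u : Sym2 W) = s(a, b)) (y : W → ℝ) :
    ∑ i, N i u * y i = N a u * y a + N b u * y b := by
  rw [Fintype.sum_eq_add a b hab fun i hi => ?_]
  rw [hN.apply_eq_zero_iff.2 (by simpa [hu] using hi), zero_mul]

theorem transpose_mul_self_apply_self [Fintype W] (hN : IsSignedIncMatrix φ N) (u : V) :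
    (Nᵀ * N) u u = 2 := by
  simp only [mul_apply, transpose_apply, hN.mul_self_apply]
  exact T.sum_incMatrix_apply_of_mem_edgeSet (φ u).2

theorem abs_eq_of_adj [Fintype W] (hN : IsSignedIncMatrix φ N) {y : W → ℝ} (hy : Nᵀ *ᵥ y = 0)
    {a b : W} (hab : T.Adj a b) : |y a| = |y b| := by
  obtain ⟨u, hu⟩ := φ.surjective ⟨s(a, b), hab⟩
  have hsum : N a u * y a + N b u * y b = 0 := by
    rw [← hN.sum_apply_mul hab.ne (by rw [hu])]
    exact congrFun hy u
  have habs : ∀ i ∈ s(a, b), |N i u| = 1 := fun i hi => by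
    rw [hN, hu, T.incMatrix_of_mem_incidenceSet ⟨hab, hi⟩]
  simpa [abs_mul, habs] using congrArg abs (eq_neg_of_add_eq_zero_left hsum)

/- As `N` has more rows than columns, `Nᵀ * y = 0` for some `y ≠ 0`; by connectedness `|y|` is
constant, so multiplying the rows of `N` by the signs of `y` makes the columns sum to `0`. -/
theorem exists_isOrientedIncMatrix [Finite V] [Fintype W] (hN : IsSignedIncMatrix φ N)
    (hT : T.IsTree) : ∃ M, IsOrientedIncMatrix φ M ∧ Mᵀ * M = Nᵀ * N := by
  have := Fintype.ofFinite V
  obtain ⟨y, hy, hy0⟩ : ∃ y ∈ LinearMap.ker Nᵀ.mulVecLin, y ≠ 0 := by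
    refine Submodule.exists_mem_ne_zero_of_ne_bot (LinearMap.ker_ne_bot_of_finrank_lt ?_)
    have hcard := (SimpleGraph.isTree_iff_connected_and_card.1 hT).2
    rw [← Nat.card_congr φ, Nat.card_eq_fintype_card, Nat.card_eq_fintype_card] at hcard
    simp only [Module.finrank_fintype_fun_eq_card]
    omega
  obtain ⟨k, hk⟩ := Function.ne_iff.1 hy0
  have hconst : ∀ i, |y i| = |y k| := fun i =>
    T.lapMatrix_mulVec_eq_zero_iff_forall_reachable.1
      (T.lapMatrix_mulVec_eq_zero_iff_forall_adj.2 fun _ _ => hN.abs_eq_of_adj hy) i k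
      (hT.connected.preconnected i k)
  have hsign : ∀ i, |y i / y k| = 1 := fun i => by
    rw [abs_div, hconst, div_self (abs_ne_zero.2 hk)]
  refine ⟨of fun i u => y i / y k * N i u, ⟨fun i u => ?_, fun u => ?_⟩, ?_⟩
  · rw [of_apply, abs_mul, hsign, one_mul, hN]
  · simp only [of_apply, div_mul_eq_mul_div, mul_comm (y _) (N _ u), ← Finset.sum_div]
    rw [div_eq_zero_iff]
    exact Or.inl (congrFun hy u)
  · ext u w
    simp only [mul_apply, transpose_apply, of_apply, mul_mul_mul_comm (y _ / y k) _ (y _ / y k),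
      ← abs_mul_abs_self (y _ / y k), hsign, one_mul]

end IsSignedIncMatrix

namespace IsOrientedIncMatrix

variable {φ : V ≃ T.edgeSet} {N : Matrix W V ℝ}

theorem mul_apply_of_ne [Fintype W] (hN : IsOrientedIncMatrix φ N) {i j : W} (hij : i ≠ j)
    (u : V) : N i u * N j u = -(T.incMatrix ℝ i (φ u) * T.incMatrix ℝ j (φ u)) := by
  by_cases hu : (φ u : Sym2 W) = s(i, j)
  · have hsum : N i u + N j u = 0 := by
      simpa [hN.sum_eq_zero] using (hN.isSigned.sum_apply_mul hij hu 1).symm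
    have hNj : N j u = -N i u := eq_neg_of_add_eq_zero_right hsum
    rw [← hN.isSigned i, ← hN.isSigned j, hNj, abs_neg, abs_mul_abs_self, mul_neg]
  · rw [← hN.isSigned i, ← hN.isSigned j, ← abs_mul]
    have hzero : N i u * N j u = 0 := by
      by_contra h
      rw [mul_eq_zero, hN.isSigned.apply_eq_zero_iff, hN.isSigned.apply_eq_zero_iff] at h
      push Not at h
      exact hu ((Sym2.mem_and_mem_iff hij).1 h)
    rw [hzero, abs_zero, neg_zero]

theorem mul_transpose [Fintype V] [Fintype W] (hN : IsOrientedIncMatrix φ N) :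
    N * Nᵀ = T.lapMatrix ℝ := by
  have hinc : ∀ i j, ∑ u, T.incMatrix ℝ i (φ u) * T.incMatrix ℝ j (φ u) =
      if i = j then (T.degree i : ℝ) else if T.Adj i j then 1 else 0 := fun i j => by
    have hentry := congrFun₂ (T.incMatrix_mul_transpose (R := ℝ)) i j
    simp only [mul_apply, transpose_apply, of_apply] at hentry
    rw [← hentry]
    refine Fintype.sum_of_injective (fun u => (φ u : Sym2 W))
      (Subtype.val_injective.comp φ.injective) _ _ (fun e he => ?_) fun _ => rfl
    rw [T.incMatrix_of_notMem_incidenceSet fun h => he ⟨φ.symm ⟨e, h.1⟩, by simp⟩, zero_mul]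
  have hdiag : ∀ i u, N i u * N i u = T.incMatrix ℝ i (φ u) * T.incMatrix ℝ i (φ u) :=
    fun i u => by rw [← hN.isSigned, abs_mul_abs_self]
  ext i j
  rw [mul_apply]
  rcases eq_or_ne i j with rfl | hij
  · simp [hdiag, hinc, SimpleGraph.lapMatrix, SimpleGraph.degMatrix]
  · simp [hN.mul_apply_of_ne hij, hinc, hij, SimpleGraph.lapMatrix, SimpleGraph.degMatrix]

end IsOrientedIncMatrix

end SignedIncidence

namespace EdgeSignedGraph

open Matrix

variable {V : Type*} {G : EdgeSignedGraph V} {u w : V}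

theorem adjMatrix_comm (G : EdgeSignedGraph V) (u w : V) : G.adjMatrix u w = G.adjMatrix w u :=
  G.adjMatrix_isHermitian.apply w u

theorem adjMatrix_self (G : EdgeSignedGraph V) (u : V) : G.adjMatrix u u = 0 := by
  simp [adjMatrix]

theorem adjMatrix_eq_one_or_neg_one (h : G.underlying.Adj u w) :
    G.adjMatrix u w = 1 ∨ G.adjMatrix u w = -1 := by
  by_cases hpos : G.pos.Adj u w
  · exact Or.inl (if_pos hpos)
  · exact Or.inr ((if_neg hpos).trans (if_pos (h.resolve_left hpos)))

theorem adjMatrix_eq_zero_iff : G.adjMatrix u w = 0 ↔ ¬ G.underlying.Adj u w := by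
  refine ⟨fun h hadj => ?_, fun h => ?_⟩
  · rcases adjMatrix_eq_one_or_neg_one hadj with h' | h' <;> norm_num [h] at h'
  · obtain ⟨hpos, hneg⟩ := not_or.1 h
    exact (if_neg hpos).trans (if_neg hneg)

theorem modAdjMatrix_eq_sub_single [DecidableEq V] (G : EdgeSignedGraph V) (v : V) :
    G.modAdjMatrix v = G.adjMatrix - single v v 1 := by
  ext u w
  by_cases h : u = v ∧ w = v
  · simp [modAdjMatrix, h, adjMatrix_self]
  · simp [modAdjMatrix, h, eq_comm (a := v)]

/-- Every triangle of `G` contains an even number of `(-)`-edges: with signs `±1`, the product of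
two of them is then the third. -/
def TrianglesPositive (G : EdgeSignedGraph V) : Prop :=
  ∀ ⦃a b c⦄, G.underlying.Adj a b → G.underlying.Adj b c → G.underlying.Adj a c →
    G.adjMatrix a b * G.adjMatrix a c = G.adjMatrix b c

/- The principal minor of `A(G) + 2I` at a triangle is `2 + 2σ`, with `σ` the product of its
signs. -/
theorem trianglesPositive_of_neg_two_lt [Fintype V] (hG : -2 < smallestEigenvalue G.adjMatrix) :
    G.TrianglesPositive := by
  classical
  intro a b c hab hbc hac
  have : Nonempty V := ⟨a⟩
  have hinj : Function.Injective ![a, b, c] := by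
    intro i j
    fin_cases i <;> fin_cases j <;>
      simp [hab.ne, hbc.ne, hac.ne, hab.ne', hbc.ne', hac.ne']
  have hdet : 0 < 8 - 2 * (G.adjMatrix a b ^ 2 + G.adjMatrix b c ^ 2 + G.adjMatrix a c ^ 2) +
      2 * (G.adjMatrix a b * G.adjMatrix b c * G.adjMatrix a c) := by
    convert! (((posDef_add_smul_one_iff G.adjMatrix_isHermitian).2 hG).submatrix hinj).det_pos
      using 1
    rw [det_fin_three]
    simp only [submatrix_apply, Matrix.add_apply, Matrix.smul_apply, one_apply, cons_val_zero,
      cons_val_one, cons_val, adjMatrix_self, G.adjMatrix_comm b a, G.adjMatrix_comm c, hab.ne,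
      hbc.ne, hac.ne, hab.ne', hbc.ne', hac.ne', if_true, if_false, smul_eq_mul]
    ring
  rcases adjMatrix_eq_one_or_neg_one hab with h | h <;>
    rcases adjMatrix_eq_one_or_neg_one hbc with h' | h' <;>
    rcases adjMatrix_eq_one_or_neg_one hac with h'' | h'' <;>
    (rw [h, h', h''] at hdet ⊢; linarith)

theorem TrianglesPositive.exists_sign_of_isClique (hG : G.TrianglesPositive) {K : Set V}
    (hK : G.underlying.IsClique K) :
    ∃ s : V → ℝ, (∀ u ∈ K, |s u| = 1) ∧ K.Pairwise fun u w => G.adjMatrix u w = s u * s w := by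
  classical
  rcases K.eq_empty_or_nonempty with rfl | ⟨a, ha⟩
  · exact ⟨0, by simp, Set.pairwise_empty _⟩
  have hadj : ∀ {u}, u ∈ K → u ≠ a → G.underlying.Adj a u := fun hu hua => hK ha hu hua.symm
  refine ⟨fun u => if u = a then 1 else G.adjMatrix a u, fun u hu => ?_, fun u hu w hw huw => ?_⟩
  · dsimp only
    split_ifs with hua
    · exact abs_one
    · rcases adjMatrix_eq_one_or_neg_one (hadj hu hua) with h | h <;> simp [h]
  · dsimp only
    split_ifs with hua hwa hwa
    · exact absurd (hua.trans hwa.symm) huw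
    · rw [hua, one_mul]
    · rw [hwa, mul_one, adjMatrix_comm]
    · exact (hG (hadj hu hua) (hK hu hw huw) (hadj hw hwa)).symm

section TreeLineGraph

variable {V W : Type*} [Fintype W] [DecidableEq W] {G : EdgeSignedGraph V} {T : SimpleGraph W}
  [DecidableRel T.Adj]

theorem TrianglesPositive.exists_isSignedIncMatrix [DecidableEq V] (hG : G.TrianglesPositive)
    (φ : G.underlying ≃g T.lineGraph) :
    ∃ N, IsSignedIncMatrix φ.toEquiv N ∧ Nᵀ * N = G.adjMatrix + (2 : ℝ) • 1 := by
  have hadj : ∀ {u w}, G.underlying.Adj u w ↔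
      u ≠ w ∧ ∃ i, i ∈ (φ u : Sym2 W) ∧ i ∈ (φ w : Sym2 W) := fun {u w} => by
    rw [← φ.map_adj_iff, SimpleGraph.lineGraph_adj_iff_exists, φ.injective.ne_iff]
  have hclique : ∀ i, G.underlying.IsClique {u | i ∈ (φ u : Sym2 W)} :=
    fun i u hu w hw huw => hadj.2 ⟨huw, i, hu, hw⟩
  choose s hs hsA using fun i => hG.exists_sign_of_isClique (hclique i)
  let N : Matrix W V ℝ := of fun i u => if i ∈ (φ u : Sym2 W) then s i u else 0
  have hN : IsSignedIncMatrix φ.toEquiv N := fun i u => by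
    by_cases hi : i ∈ (φ u : Sym2 W)
    · simpa [N, hi, T.incMatrix_of_mem_incidenceSet ⟨(φ u).2, hi⟩] using hs i u hi
    · simp [N, hi, T.incMatrix_of_notMem_incidenceSet fun h => hi h.2]
  refine ⟨N, hN, ?_⟩
  ext u w
  rcases eq_or_ne u w with rfl | huw
  · simp [hN.transpose_mul_self_apply_self, adjMatrix_self]
  have hterm : ∀ i, N i u * N i w =
      if i ∈ (φ u : Sym2 W) ∧ i ∈ (φ w : Sym2 W) then G.adjMatrix u w else 0 := fun i => by
    by_cases h : i ∈ (φ u : Sym2 W) ∧ i ∈ (φ w : Sym2 W)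
    · simp only [N, of_apply, if_pos h, if_pos h.1, if_pos h.2, hsA i h.1 h.2 huw]
    · rw [if_neg h, mul_eq_zero, hN.apply_eq_zero_iff, hN.apply_eq_zero_iff]
      exact not_and_or.1 h
  simp only [mul_apply, transpose_apply, hterm, Matrix.add_apply, Matrix.smul_apply,
    one_apply_ne huw, smul_zero, add_zero]
  by_cases h : G.underlying.Adj u w
  · obtain ⟨-, i, hu, hw⟩ := hadj.1 h
    rw [Fintype.sum_eq_single i fun j hji => if_neg fun hj => huw <| φ.injective <| Subtype.ext <|
      Sym2.eq_of_ne_mem hji hj.1 hu hj.2 hw, if_pos ⟨hu, hw⟩]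
  · simp [adjMatrix_eq_zero_iff.2 h]

theorem modAdjMatrix_add_two_smul_one [DecidableEq V] {φ : V ≃ T.edgeSet} {M : Matrix W V ℝ}
    (hM : IsSignedIncMatrix φ M) (hMG : Mᵀ * M = G.adjMatrix + (2 : ℝ) • 1) {r : W} {v : V}
    (hr : (T.neighborSet r).ncard = 1) (hrv : r ∈ (φ v : Sym2 W)) :
    Mᵀ.submatrix id (Subtype.val : {i // i ≠ r} → W) *
      M.submatrix (Subtype.val : {i // i ≠ r} → W) id = G.modAdjMatrix v + (2 : ℝ) • 1 := by
  have hrow : ∀ u w, M r u * M r w = single v v (1 : ℝ) u w := fun u w => by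
    have hzero : ∀ {u}, u ≠ v → M r u = 0 := fun huv => hM.apply_eq_zero_iff.2 fun hu =>
      huv <| φ.injective <| eq_of_mem_of_ncard_neighborSet_eq_one hr hu hrv
    by_cases hu : u = v <;> by_cases hw : w = v
    · rw [hu, hw, hM.mul_self_apply, T.incMatrix_of_mem_incidenceSet ⟨(φ v).2, hrv⟩,
        single_apply_same]
    all_goals simp [hzero, single, hu, hw, Ne.symm]
  rw [modAdjMatrix_eq_sub_single, sub_add_eq_add_sub, ← hMG]
  ext u w
  rw [Matrix.sub_apply, mul_apply, mul_apply, ← hrow, Fintype.sum_eq_add_sum_subtype_ne _ r]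
  simp

theorem smallestEigenvalue_modAdjMatrix_add_two [Fintype V] [DecidableEq V] (hT : T.IsTree)
    {φ : V ≃ T.edgeSet} {M : Matrix W V ℝ} (hM : IsOrientedIncMatrix φ M)
    (hMG : Mᵀ * M = G.adjMatrix + (2 : ℝ) • 1) {r : W} {v : V}
    (hr : (T.neighborSet r).ncard = 1) (hrv : r ∈ (φ v : Sym2 W)) :
    smallestEigenvalue (G.modAdjMatrix v) + 2 = smallestEigenvalue (groundedLapMatrix T r) := by
  have : Nonempty V := ⟨v⟩
  have hcard : Fintype.card V = Fintype.card {i // i ≠ r} := by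
    have h := (SimpleGraph.isTree_iff_connected_and_card.1 hT).2
    rw [← Nat.card_congr φ, Nat.card_eq_fintype_card, Nat.card_eq_fintype_card] at h
    rw [Fintype.card_subtype_compl, Fintype.card_subtype_eq, ← h, Nat.add_sub_cancel]
  rw [← smallestEigenvalue_add_smul_one (G.modAdjMatrix_isHermitian v),
    ← modAdjMatrix_add_two_smul_one hM.isSigned hMG hr hrv, smallestEigenvalue_mul_comm hcard,
    groundedLapMatrix, ← hM.mul_transpose]
  rfl

theorem neg_two_lt_and_lt_of_isTreeLineGraphAtEndEdge {V : Type*} [Fintype V]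
    {G : EdgeSignedGraph V} {v : V} (hG : -2 < smallestEigenvalue G.adjMatrix)
    (h : G.underlying.IsTreeLineGraphAtEndEdge v) :
    -2 < smallestEigenvalue (G.modAdjMatrix v) ∧
      smallestEigenvalue (G.modAdjMatrix v) < smallestEigenvalue G.adjMatrix := by
  classical
  obtain ⟨W, _, T, hT, φ, r, hrv, hr⟩ := h
  have := Fintype.ofFinite W
  have : Nonempty V := ⟨v⟩
  obtain ⟨N, hN, hNG⟩ := (trianglesPositive_of_neg_two_lt hG).exists_isSignedIncMatrix φ
  obtain ⟨M, hM, hMN⟩ := hN.exists_isOrientedIncMatrix hT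
  have hMG := hMN.trans hNG
  have hmod := smallestEigenvalue_modAdjMatrix_add_two hT hM hMG hr hrv
  have hne : smallestEigenvalue G.adjMatrix + 2 ≠ 0 := by linarith
  have heigen : Module.End.HasEigenvalue (T.lapMatrix ℝ).mulVecLin
      (smallestEigenvalue G.adjMatrix + 2) := by
    rw [← hM.mul_transpose]
    refine hasEigenvalue_mul_comm hne ?_
    rw [hMG, hasEigenvalue_add_smul_one_iff, add_sub_cancel_right]
    exact (isLeast_smallestEigenvalue G.adjMatrix_isHermitian).1
  obtain ⟨x, hx⟩ := Set.ncard_eq_one.1 hr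
  have : Nonempty {i // i ≠ r} := ⟨⟨x, (show T.Adj r x from hx.superset rfl).ne'⟩⟩
  have hpos := (posDef_iff_smallestEigenvalue_pos isHermitian_groundedLapMatrix).1
    (posDef_groundedLapMatrix (r := r) hT.connected)
  have hlt := smallestEigenvalue_groundedLapMatrix_lt hT.connected hr hne heigen
  constructor <;> linarith

end TreeLineGraph

end EdgeSignedGraph

section PairGraph

variable {V W : Type*} {ε : V → Sym2 W}

/-- The graph on `W` whose edges are the pairs `ε u`. A graph on `V` in which adjacency means that
the pairs meet is the line graph of `pairGraph ε`, as soon as the pairs are distinct. -/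
def pairGraph (ε : V → Sym2 W) : SimpleGraph W := SimpleGraph.fromEdgeSet (Set.range ε)

theorem edgeSet_pairGraph (hdiag : ∀ u, ¬ (ε u).IsDiag) :
    (pairGraph ε).edgeSet = Set.range ε := by
  rw [pairGraph, SimpleGraph.edgeSet_fromEdgeSet, sdiff_eq_left, Set.disjoint_left]
  rintro _ ⟨u, rfl⟩
  exact hdiag u

theorem reachable_pairGraph_of_mem {u : V} {i j : W} (hi : i ∈ ε u) (hj : j ∈ ε u) :
    (pairGraph ε).Reachable i j := by
  rcases eq_or_ne i j with rfl | hij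
  · exact .refl _
  · refine SimpleGraph.Adj.reachable <| (SimpleGraph.fromEdgeSet_adj _).2 ⟨⟨u, ?_⟩, hij⟩
    exact (Sym2.mem_and_mem_iff hij).1 ⟨hi, hj⟩

theorem reachable_pairGraph_of_reachable {H : SimpleGraph V}
    (hadj : ∀ u w, H.Adj u w → ∃ k, k ∈ ε u ∧ k ∈ ε w) {u w : V} (huw : H.Reachable u w) :
    ∀ {i j : W}, i ∈ ε u → j ∈ ε w → (pairGraph ε).Reachable i j := by
  obtain ⟨q⟩ := huw
  induction q with
  | nil => exact reachable_pairGraph_of_mem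
  | cons h _ ih =>
    intro i j hi hj
    obtain ⟨k, hku, hkw⟩ := hadj _ _ h
    exact (reachable_pairGraph_of_mem hi hku).trans (ih hkw hj)

theorem connected_pairGraph {H : SimpleGraph V} (hH : H.Preconnected) [Nonempty W]
    (hadj : ∀ u w, H.Adj u w → ∃ k, k ∈ ε u ∧ k ∈ ε w) (hcov : ∀ k, ∃ u, k ∈ ε u) :
    (pairGraph ε).Connected := by
  refine ⟨fun i j => ?_⟩
  obtain ⟨u, hi⟩ := hcov i
  obtain ⟨w, hj⟩ := hcov j
  exact reachable_pairGraph_of_reachable hadj (hH u w) hi hj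

/- A connected graph has at most one more vertex than edges, so `hcard` forces equality
throughout. -/
theorem isTree_pairGraph_and_injective [Finite V] (hdiag : ∀ u, ¬ (ε u).IsDiag)
    (hconn : (pairGraph ε).Connected) (hcard : Nat.card V + 1 ≤ Nat.card W) :
    (pairGraph ε).IsTree ∧ Function.Injective ε := by
  have hedges : Nat.card (pairGraph ε).edgeSet = Nat.card (Set.range ε) := by
    rw [edgeSet_pairGraph hdiag]
  have hrange : Nat.card (Set.range ε) ≤ Nat.card V := Finite.card_range_le ε
  have hbound := hconn.card_vert_le_card_edgeSet_add_one
  have : Finite W := Nat.finite_of_card_ne_zero (by omega)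
  refine ⟨SimpleGraph.isTree_iff_connected_and_card.2 ⟨hconn, by omega⟩, ?_⟩
  have hbij : Function.Bijective (Set.rangeFactorization ε) :=
    (Nat.bijective_iff_surjective_and_card _).2 ⟨Set.rangeFactorization_surjective, by omega⟩
  exact Set.rangeFactorization_injective.1 hbij.1

theorem ncard_neighborSet_pairGraph_eq_one (hdiag : ∀ u, ¬ (ε u).IsDiag) {r : W} {v : V}
    (hr : ∀ u, r ∈ ε u ↔ u = v) : ((pairGraph ε).neighborSet r).ncard = 1 := by
  obtain ⟨j, hj⟩ := (hr v).2 rfl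
  refine Set.ncard_eq_one.2 ⟨j, Set.ext fun k => ?_⟩
  rw [SimpleGraph.mem_neighborSet, ← SimpleGraph.mem_edgeSet, edgeSet_pairGraph hdiag,
    Set.mem_singleton_iff]
  refine ⟨fun ⟨u, hu⟩ => ?_, fun hk => ⟨v, hk ▸ hj⟩⟩
  obtain rfl := (hr u).1 (hu ▸ Sym2.mem_mk_left r k)
  exact Sym2.congr_right.1 (hu.symm.trans hj)

theorem isTreeLineGraphAtEndEdge_of_pairs [Finite V] {W : Type} {H : SimpleGraph V}
    (hH : H.Preconnected) {ε : V → Sym2 W} (hdiag : ∀ u, ¬ (ε u).IsDiag)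
    (hadj : ∀ u w, H.Adj u w → ∃ k, k ∈ ε u ∧ k ∈ ε w)
    (hadj' : ∀ u w, ε u ≠ ε w → (∃ k, k ∈ ε u ∧ k ∈ ε w) → H.Adj u w)
    (hcov : ∀ k, ∃ u, k ∈ ε u) (hcard : Nat.card V + 1 ≤ Nat.card W) {r : W} {v : V}
    (hr : ∀ u, r ∈ ε u ↔ u = v) : H.IsTreeLineGraphAtEndEdge v := by
  have : Nonempty W := ⟨r⟩
  obtain ⟨htree, hinj⟩ := isTree_pairGraph_and_injective hdiag
    (connected_pairGraph hH hadj hcov) hcard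
  let φ : V ≃ (pairGraph ε).edgeSet :=
    (Equiv.ofInjective ε hinj).trans (Equiv.setCongr (edgeSet_pairGraph hdiag).symm)
  refine ⟨W, Nat.finite_of_card_ne_zero (by omega), pairGraph ε, htree, ⟨φ, fun {u w} => ?_⟩, r,
    (hr v).2 rfl, ncard_neighborSet_pairGraph_eq_one hdiag hr⟩
  rw [SimpleGraph.lineGraph_adj_iff_exists, φ.injective.ne_iff]
  exact ⟨fun h => hadj' u w (hinj.ne h.1) h.2, fun h => ⟨h.ne, hadj u w h⟩⟩

end PairGraph

section IntegralLattice

open scoped InnerProductSpace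

variable {E : Type*} [NormedAddCommGroup E] [InnerProductSpace ℝ E]

/-- A subgroup of a real inner product space is an integral lattice if the inner product of any two
of its elements is an integer. -/
def IsIntegralLattice (Z : AddSubgroup E) : Prop :=
  ∀ y ∈ Z, ∀ z ∈ Z, ⟪y, z⟫_ℝ ∈ (Int.castAddHom ℝ).range

theorem isIntegralLattice_closure {s : Set E}
    (hs : ∀ y ∈ s, ∀ z ∈ s, ⟪y, z⟫_ℝ ∈ (Int.castAddHom ℝ).range) :
    IsIntegralLattice (AddSubgroup.closure s) := fun y hy z hz => by
  induction hy, hz using AddSubgroup.closure_induction₂ with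
  | mem y z hy hz => exact hs y hy z hz
  | zero_left z => rw [inner_zero_left]; exact zero_mem _
  | zero_right y => rw [inner_zero_right]; exact zero_mem _
  | add_left x y z _ _ _ hx hy => rw [inner_add_left]; exact add_mem hx hy
  | add_right y z x _ _ _ hy hz => rw [inner_add_right]; exact add_mem hy hz
  | neg_left y z _ _ h => rw [inner_neg_left]; exact neg_mem h
  | neg_right y z _ _ h => rw [inner_neg_right]; exact neg_mem h

/-- `y` is the sum of two orthogonal unit vectors of `Z`. -/
def IsSumOfOrthogonalUnits (Z : AddSubgroup E) (y : E) : Prop :=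
  ∃ b ∈ Z, ∃ c ∈ Z, ‖b‖ = 1 ∧ ‖c‖ = 1 ∧ ⟪b, c⟫_ℝ = 0 ∧ y = b + c

/-- `S` consists of pairwise orthogonal unit vectors of `Z`, one from each pair `{a, -a}` of
opposite unit vectors of `Z`. -/
structure IsUnitFrame (Z : AddSubgroup E) (S : Set E) : Prop where
  subset : S ⊆ Z
  orthonormal : Orthonormal ℝ ((↑) : S → E)
  mem_or_neg_mem : ∀ a ∈ Z, ‖a‖ = 1 → a ∈ S ∨ -a ∈ S

namespace IsIntegralLattice

variable {Z : AddSubgroup E} (hZ : IsIntegralLattice Z) {a b y z : E}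
include hZ

theorem inner_eq_one_or_neg_one (ha : a ∈ Z) (hy : y ∈ Z) (hay : ‖a‖ ^ 2 * ‖y‖ ^ 2 < 4)
    (h : ⟪a, y⟫_ℝ ≠ 0) : ⟪a, y⟫_ℝ = 1 ∨ ⟪a, y⟫_ℝ = -1 := by
  obtain ⟨k, hk : (k : ℝ) = ⟪a, y⟫_ℝ⟩ := hZ a ha y hy
  have hsq : (k : ℝ) ^ 2 < 2 ^ 2 := by
    have hcs := real_inner_mul_inner_self_le a y
    simp only [← hk, real_inner_self_eq_norm_sq] at hcs
    linarith
  have habs : |k| < 2 := by exact_mod_cast abs_lt_of_sq_lt_sq hsq two_pos.le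
  have hne : k ≠ 0 := fun hk0 => h (by rw [← hk, hk0, Int.cast_zero])
  have hk1 : k = 1 ∨ k = -1 := by rw [abs_lt] at habs; omega
  rw [← hk]
  exact_mod_cast hk1

theorem eq_or_eq_neg (ha : a ∈ Z) (hb : b ∈ Z) (ha1 : ‖a‖ = 1) (hb1 : ‖b‖ = 1)
    (h : ⟪a, b⟫_ℝ ≠ 0) : a = b ∨ a = -b := by
  rw [← inner_eq_one_iff_of_norm_eq_one (𝕜 := ℝ) ha1 hb1,
    ← inner_eq_neg_one_iff_of_norm_eq_one (𝕜 := ℝ) ha1 hb1]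
  exact hZ.inner_eq_one_or_neg_one ha hb (by norm_num [ha1, hb1]) h

theorem isSumOfOrthogonalUnits_of_inner_ne_zero (ha : a ∈ Z) (hy : y ∈ Z) (ha1 : ‖a‖ = 1)
    (hy2 : ‖y‖ ^ 2 = 2) (h : ⟪a, y⟫_ℝ ≠ 0) : IsSumOfOrthogonalUnits Z y := by
  obtain ⟨b, hb, hb1, hby⟩ : ∃ b ∈ Z, ‖b‖ = 1 ∧ ⟪b, y⟫_ℝ = 1 := by
    rcases hZ.inner_eq_one_or_neg_one ha hy (by norm_num [ha1, hy2]) h with h | h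
    · exact ⟨a, ha, ha1, h⟩
    · exact ⟨-a, neg_mem ha, by rw [norm_neg, ha1], by rw [inner_neg_left, h, neg_neg]⟩
  refine ⟨b, hb, y - b, sub_mem hy hb, hb1, ?_, ?_, (add_sub_cancel b y).symm⟩
  · have hsq := norm_sub_sq_real y b
    rw [real_inner_comm, hby, hy2, hb1] at hsq
    rw [← pow_left_inj₀ (norm_nonneg _) one_pos.le two_ne_zero, hsq]
    norm_num
  · rw [inner_sub_right, hby, real_inner_self_eq_norm_sq, hb1, one_pow, sub_self]

theorem isSumOfOrthogonalUnits_of_isSumOfOrthogonalUnits (hy : IsSumOfOrthogonalUnits Z y)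
    (hz : z ∈ Z) (hz2 : ‖z‖ ^ 2 = 2) (h : ⟪y, z⟫_ℝ ≠ 0) : IsSumOfOrthogonalUnits Z z := by
  obtain ⟨b, hb, c, hc, hb1, hc1, -, rfl⟩ := hy
  rcases ne_or_eq ⟪b, z⟫_ℝ 0 with hbz | hbz
  · exact hZ.isSumOfOrthogonalUnits_of_inner_ne_zero hb hz hb1 hz2 hbz
  · rw [inner_add_left, hbz, zero_add] at h
    exact hZ.isSumOfOrthogonalUnits_of_inner_ne_zero hc hz hc1 hz2 h

theorem exists_isUnitFrame : ∃ S, IsUnitFrame Z S := by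
  obtain ⟨S, hS, hbij⟩ := Set.exists_subset_bijOn {a | a ∈ Z ∧ ‖a‖ = 1} fun a => s(a, -a)
  have hpair : ∀ {a b : E}, s(a, -a) = s(b, -b) ↔ a = b ∨ a = -b := fun {a b} => by
    rw [Sym2.eq_iff, neg_inj, and_self, neg_eq_iff_eq_neg, and_self]
  refine ⟨S, fun a ha => (hS ha).1, ⟨fun a => (hS a.2).2, fun a b hab => ?_⟩, fun a ha ha1 => ?_⟩
  · by_contra h
    have heq := hZ.eq_or_eq_neg (hS a.2).1 (hS b.2).1 (hS a.2).2 (hS b.2).2 h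
    exact hab (Subtype.ext (hbij.injOn a.2 b.2 (hpair.2 heq)))
  · obtain ⟨b, hb, hab⟩ := hbij.surjOn (Set.mem_image_of_mem _ ⟨ha, ha1⟩)
    rcases hpair.1 hab with rfl | rfl
    · exact Or.inl hb
    · exact Or.inr hb

end IsIntegralLattice

/-- `y` is a combination, with nonzero coefficients, of the two distinct members of the family `e`
indexed by the pair `p`. -/
def IsSupportPair {ι : Type*} (e : ι → E) (p : Sym2 ι) (y : E) : Prop :=
  ∃ i j, i ≠ j ∧ p = s(i, j) ∧ ∃ α β : ℝ, α ≠ 0 ∧ β ≠ 0 ∧ y = α • e i + β • e j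

namespace IsSupportPair

variable {ι : Type*} {e : ι → E} {p q : Sym2 ι} {y z : E}

theorem not_isDiag (hp : IsSupportPair e p y) : ¬ p.IsDiag := by
  obtain ⟨i, j, hij, rfl, -⟩ := hp
  exact hij

theorem mem_span (hp : IsSupportPair e p y) : y ∈ Submodule.span ℝ (Set.range e) := by
  obtain ⟨i, j, -, -, α, β, -, -, rfl⟩ := hp
  exact add_mem (Submodule.smul_mem _ _ (Submodule.subset_span ⟨i, rfl⟩))
    (Submodule.smul_mem _ _ (Submodule.subset_span ⟨j, rfl⟩))

theorem inner_ne_zero_iff (hp : IsSupportPair e p y) (he : Orthonormal ℝ e) {k : ι} :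
    ⟪y, e k⟫_ℝ ≠ 0 ↔ k ∈ p := by
  classical
  obtain ⟨i, j, hij, rfl, α, β, hα, hβ, rfl⟩ := hp
  simp only [inner_add_left, real_inner_smul_left, orthonormal_iff_ite.1 he, Sym2.mem_iff,
    eq_comm (b := k)]
  by_cases hi : k = i <;> by_cases hj : k = j <;> simp_all

theorem inner_eq_zero (hp : IsSupportPair e p y) (he : Orthonormal ℝ e) {k : ι} (hk : k ∉ p) :
    ⟪e k, y⟫_ℝ = 0 := by
  rw [real_inner_comm]
  exact not_not.1 (mt (hp.inner_ne_zero_iff he).1 hk)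

theorem exists_mem_mem_of_inner_ne_zero (hp : IsSupportPair e p y) (hq : IsSupportPair e q z)
    (he : Orthonormal ℝ e) (h : ⟪y, z⟫_ℝ ≠ 0) : ∃ k, k ∈ p ∧ k ∈ q := by
  by_contra! hdisj
  obtain ⟨i, j, -, rfl, α, β, -, -, rfl⟩ := hp
  apply h
  rw [inner_add_left, real_inner_smul_left, real_inner_smul_left,
    hq.inner_eq_zero he (hdisj i (Sym2.mem_mk_left i j)),
    hq.inner_eq_zero he (hdisj j (Sym2.mem_mk_right i j)), mul_zero, mul_zero, add_zero]

theorem exists_eq_of_mem (hp : IsSupportPair e p y) {k : ι} (hk : k ∈ p) :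
    ∃ j ≠ k, p = s(k, j) ∧ ∃ α β : ℝ, α ≠ 0 ∧ y = α • e k + β • e j := by
  obtain ⟨i, j, hij, rfl, α, β, hα, hβ, rfl⟩ := hp
  rcases Sym2.mem_iff.1 hk with rfl | rfl
  · exact ⟨j, hij.symm, rfl, α, β, hα, rfl⟩
  · exact ⟨i, hij, Sym2.eq_swap, β, α, hβ, add_comm _ _⟩

theorem inner_ne_zero_of_mem_of_mem (hp : IsSupportPair e p y) (hq : IsSupportPair e q z)
    (he : Orthonormal ℝ e) (hpq : p ≠ q) {k : ι} (hkp : k ∈ p) (hkq : k ∈ q) :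
    ⟪y, z⟫_ℝ ≠ 0 := by
  obtain ⟨j, hjk, rfl, α, β, hα, rfl⟩ := hp.exists_eq_of_mem hkp
  have hjq : j ∉ q := fun hjq => hpq ((Sym2.mem_and_mem_iff hjk.symm).1 ⟨hkq, hjq⟩).symm
  rw [inner_add_left, real_inner_smul_left, real_inner_smul_left, hq.inner_eq_zero he hjq,
    mul_zero, add_zero, real_inner_comm]
  exact mul_ne_zero hα ((hq.inner_ne_zero_iff he).2 hkq)

end IsSupportPair

theorem IsUnitFrame.exists_smul_eq {Z : AddSubgroup E} {S : Set E} (hS : IsUnitFrame Z S) {b : E}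
    (hb : b ∈ Z) (hb1 : ‖b‖ = 1) : ∃ i : S, ∃ α : ℝ, α ≠ 0 ∧ b = α • (i : E) := by
  rcases hS.mem_or_neg_mem b hb hb1 with h | h
  · exact ⟨⟨b, h⟩, 1, one_ne_zero, (one_smul ℝ b).symm⟩
  · exact ⟨⟨-b, h⟩, -1, neg_ne_zero.2 one_ne_zero, by rw [neg_one_smul, neg_neg]⟩

theorem IsUnitFrame.exists_isSupportPair {Z : AddSubgroup E} {S : Set E} (hS : IsUnitFrame Z S)
    {y : E} (hy : IsSumOfOrthogonalUnits Z y) : ∃ p, IsSupportPair ((↑) : S → E) p y := by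
  obtain ⟨b, hb, c, hc, hb1, hc1, hbc, rfl⟩ := hy
  obtain ⟨i, α, hα, rfl⟩ := hS.exists_smul_eq hb hb1
  obtain ⟨j, β, hβ, rfl⟩ := hS.exists_smul_eq hc hc1
  refine ⟨s(i, j), i, j, ?_, rfl, α, β, hα, hβ, rfl⟩
  rintro rfl
  rw [real_inner_smul_left, real_inner_smul_right, real_inner_self_eq_norm_sq,
    hS.orthonormal.1 i] at hbc
  simp [hα, hβ] at hbc

end IntegralLattice

section RootRepresentation

open scoped InnerProductSpace

/-- Linearly independent vectors `x u`, `u : V`, of squared length `2` with integral inner products,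
such that `x u` and `x w` are non-orthogonal exactly when `u` and `w` are equal or adjacent in `H`,
together with a unit vector `e` which is non-orthogonal to `x v` only. -/
structure IsRootRepresentation {V E : Type*} [NormedAddCommGroup E] [InnerProductSpace ℝ E]
    (H : SimpleGraph V) (v : V) (e : E) (x : V → E) : Prop where
  norm_unit : ‖e‖ = 1
  norm_sq : ∀ u, ‖x u‖ ^ 2 = 2
  inner_unit : ∀ u, ⟪e, x u⟫_ℝ = Set.indicator {v} 1 u
  inner_mem_int : ∀ u w, ⟪x u, x w⟫_ℝ ∈ (Int.castAddHom ℝ).range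
  inner_ne_zero_iff : ∀ {u w}, u ≠ w → (⟪x u, x w⟫_ℝ ≠ 0 ↔ H.Adj u w)
  linearIndependent : LinearIndependent ℝ fun o : Option V => o.elim e x

namespace IsRootRepresentation

section Lattice

variable {V E : Type*} [AddCommGroup E] {e : E} {x : V → E}

/-- The lattice spanned by the vectors of a root representation. -/
def lattice (e : E) (x : V → E) : AddSubgroup E :=
  AddSubgroup.closure (insert e (Set.range x))

theorem unit_mem_lattice : e ∈ lattice e x :=
  AddSubgroup.subset_closure (Set.mem_insert e _)

theorem mem_lattice (u : V) : x u ∈ lattice e x :=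
  AddSubgroup.subset_closure (Set.mem_insert_of_mem e ⟨u, rfl⟩)

end Lattice

variable {V E : Type*} [NormedAddCommGroup E] [InnerProductSpace ℝ E]
  {H : SimpleGraph V} {v : V} {e : E} {x : V → E}

theorem inner_unit_ne_zero_iff (h : IsRootRepresentation H v e x) {u : V} :
    ⟪e, x u⟫_ℝ ≠ 0 ↔ u = v := by
  rw [h.inner_unit]
  simp

theorem isIntegralLattice (h : IsRootRepresentation H v e x) :
    IsIntegralLattice (lattice e x) := by
  have hunit : ∀ u, ⟪e, x u⟫_ℝ ∈ (Int.castAddHom ℝ).range := fun u => by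
    by_cases hu : u = v
    · exact ⟨1, by simp [h.inner_unit, hu]⟩
    · exact ⟨0, by simp [h.inner_unit, hu]⟩
  refine isIntegralLattice_closure ?_
  rintro _ (rfl | ⟨u, rfl⟩) _ (rfl | ⟨w, rfl⟩)
  · exact ⟨1, by simp [h.norm_unit]⟩
  · exact hunit w
  · rw [real_inner_comm]
    exact hunit u
  · exact h.inner_mem_int u w

theorem isSumOfOrthogonalUnits (h : IsRootRepresentation H v e x) (hH : H.Preconnected) (u : V) :
    IsSumOfOrthogonalUnits (lattice e x) (x u) := by
  have hZ := h.isIntegralLattice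
  have hv : IsSumOfOrthogonalUnits (lattice e x) (x v) :=
    hZ.isSumOfOrthogonalUnits_of_inner_ne_zero unit_mem_lattice (mem_lattice v) h.norm_unit
      (h.norm_sq v) (h.inner_unit_ne_zero_iff.2 rfl)
  obtain ⟨q⟩ := hH u v
  induction q with
  | nil => exact hv
  | @cons u w _ huw _ ih =>
    exact hZ.isSumOfOrthogonalUnits_of_isSumOfOrthogonalUnits (ih h hv) (mem_lattice u)
      (h.norm_sq u) ((h.inner_ne_zero_iff huw.ne').2 huw.symm)

theorem exists_isSupportPair (h : IsRootRepresentation H v e x) (hH : H.Preconnected) :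
    ∃ (S : Set E) (ε : V → Sym2 S), IsUnitFrame (lattice e x) S ∧
      ∀ u, IsSupportPair ((↑) : S → E) (ε u) (x u) := by
  obtain ⟨S, hS⟩ := h.isIntegralLattice.exists_isUnitFrame
  choose ε hε using fun u => hS.exists_isSupportPair (h.isSumOfOrthogonalUnits hH u)
  exact ⟨S, ε, hS, hε⟩

variable {S : Set E} {ε : V → Sym2 S}

theorem exists_mem_iff_eq (h : IsRootRepresentation H v e x) (hS : IsUnitFrame (lattice e x) S)
    (hε : ∀ u, IsSupportPair ((↑) : S → E) (ε u) (x u)) :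
    ∃ r : S, (∃ α : ℝ, e = α • (r : E)) ∧ ∀ u, r ∈ ε u ↔ u = v := by
  obtain ⟨r, α, hα, he⟩ := hS.exists_smul_eq unit_mem_lattice h.norm_unit
  refine ⟨r, ⟨α, he⟩, fun u => ?_⟩
  rw [← (hε u).inner_ne_zero_iff hS.orthonormal, ← h.inner_unit_ne_zero_iff, he,
    real_inner_smul_left, real_inner_comm, mul_ne_zero_iff]
  exact (and_iff_right hα).symm

theorem exists_mem (h : IsRootRepresentation H v e x) (hS : IsUnitFrame (lattice e x) S)
    (hε : ∀ u, IsSupportPair ((↑) : S → E) (ε u) (x u)) (k : S) : ∃ u, k ∈ ε u := by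
  by_contra! hk
  obtain ⟨r, ⟨α, he⟩, hr⟩ := h.exists_mem_iff_eq hS hε
  have hkr : k ≠ r := fun hkr => hk v (hkr ▸ (hr v).2 rfl)
  have horth : lattice e x ≤ (ℝ ∙ (k : E))ᗮ.toAddSubgroup := by
    refine (AddSubgroup.closure_le _).2 ?_
    rintro _ (rfl | ⟨u, rfl⟩) <;> refine Submodule.mem_orthogonal_singleton_iff_inner_right.2 ?_
    · rw [he, real_inner_smul_right, hS.orthonormal.2 hkr, mul_zero]
    · exact (hε u).inner_eq_zero hS.orthonormal (hk u)
  have hkk : ⟪(k : E), k⟫_ℝ = 0 :=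
    Submodule.mem_orthogonal_singleton_iff_inner_right.1 (horth (hS.subset k.2))
  rw [real_inner_self_eq_norm_sq, hS.orthonormal.1 k] at hkk
  norm_num at hkk

theorem card_add_one_le [Finite V] [FiniteDimensional ℝ E] (h : IsRootRepresentation H v e x)
    (hS : IsUnitFrame (lattice e x) S)
    (hε : ∀ u, IsSupportPair ((↑) : S → E) (ε u) (x u)) : Nat.card V + 1 ≤ Nat.card S := by
  have : Finite S := hS.orthonormal.linearIndependent.finite
  have := Fintype.ofFinite V
  have := Fintype.ofFinite S
  obtain ⟨r, ⟨α, he⟩, -⟩ := h.exists_mem_iff_eq hS hε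
  have hspan : Set.range (fun o : Option V => o.elim e x) ≤ Submodule.span ℝ S := by
    rintro _ ⟨_ | u, rfl⟩
    · exact he ▸ Submodule.smul_mem _ _ (Submodule.subset_span r.2)
    · have hmem := (hε u).mem_span
      rwa [Subtype.range_coe] at hmem
  simpa only [Fintype.card_option, Nat.card_eq_fintype_card] using
    linearIndependent_le_span_aux' _ h.linearIndependent S hspan

theorem isTreeLineGraphAtEndEdge {E : Type} [NormedAddCommGroup E] [InnerProductSpace ℝ E]
    [FiniteDimensional ℝ E] [Finite V] {e : E} {x : V → E} (h : IsRootRepresentation H v e x)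
    (hH : H.Preconnected) : H.IsTreeLineGraphAtEndEdge v := by
  obtain ⟨S, ε, hS, hε⟩ := h.exists_isSupportPair hH
  obtain ⟨r, -, hr⟩ := h.exists_mem_iff_eq hS hε
  refine isTreeLineGraphAtEndEdge_of_pairs hH (fun u => (hε u).not_isDiag)
    (fun u w huw => ?_) (fun u w hne ⟨k, hku, hkw⟩ => ?_) (h.exists_mem hS hε)
    (h.card_add_one_le hS hε) hr
  · exact (hε u).exists_mem_mem_of_inner_ne_zero (hε w) hS.orthonormal
      ((h.inner_ne_zero_iff huw.ne).2 huw)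
  · exact (h.inner_ne_zero_iff (ne_of_apply_ne ε hne)).1
      ((hε u).inner_ne_zero_of_mem_of_mem (hε w) hS.orthonormal hne hku hkw)

end IsRootRepresentation

end RootRepresentation

theorem exists_gram_eq_of_posSemidef {ι : Type*} [Finite ι] {A : Matrix ι ι ℝ}
    (hA : A.PosSemidef) :
    ∃ (m : ℕ) (x : ι → EuclideanSpace ℝ (Fin m)), Matrix.gram ℝ x = A := by
  obtain ⟨m, y, rfl⟩ := Matrix.posSemidef_iff_eq_sum_vecMulVec.1 hA
  refine ⟨m, fun i => WithLp.toLp 2 fun j => y j i, ?_⟩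
  ext i j
  simp [Matrix.gram_apply, PiLp.inner_apply, Matrix.sum_apply, Matrix.vecMulVec_apply, mul_comm]

theorem linearIndependent_option_elim_of_map_eq_zero {ι K E F : Type*} [DivisionRing K]
    [AddCommGroup E] [Module K E] [AddCommGroup F] [Module K F] {x : ι → E} {e : E} (f : E →ₗ[K] F)
    (hx : LinearIndependent K (f ∘ x)) (he : f e = 0) (he0 : e ≠ 0) :
    LinearIndependent K fun o : Option ι => o.elim e x := by
  refine linearIndependent_option.2 ⟨hx.of_comp, fun hspan => he0 ?_⟩
  exact Submodule.disjoint_def.1 (Submodule.range_ker_disjoint hx) e hspan he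

namespace EdgeSignedGraph

variable {V : Type*} {G : EdgeSignedGraph V} {v : V}

open scoped InnerProductSpace

theorem adjMatrix_mem_int (G : EdgeSignedGraph V) (u w : V) :
    G.adjMatrix u w ∈ (Int.castAddHom ℝ).range := by
  by_cases h : G.underlying.Adj u w
  · rcases adjMatrix_eq_one_or_neg_one h with h' | h'
    · exact ⟨1, by simp [h']⟩
    · exact ⟨-1, by simp [h']⟩
  · exact (adjMatrix_eq_zero_iff.2 h).symm ▸ zero_mem _

variable [Fintype V]

/- Gram vectors of `Â(G, v) + 2I`, with the indicator of `v` as an additional coordinate, have Gram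
matrix `A(G) + 2I`; the unit vector of that coordinate serves as `e`. -/
theorem exists_isRootRepresentation (hv : -2 < smallestEigenvalue (G.modAdjMatrix v)) :
    ∃ (m : ℕ) (e : WithLp 2 (ℝ × EuclideanSpace ℝ (Fin m))) (x : V → _),
      IsRootRepresentation G.underlying v e x := by
  classical
  have : Nonempty V := ⟨v⟩
  have hpos := (posDef_add_smul_one_iff (G.modAdjMatrix_isHermitian v)).2 hv
  obtain ⟨m, x, hx⟩ := exists_gram_eq_of_posSemidef hpos.posSemidef
  let y : V → WithLp 2 (ℝ × EuclideanSpace ℝ (Fin m)) := fun u =>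
    WithLp.toLp 2 (Set.indicator {v} 1 u, x u)
  have hy : ∀ u w, ⟪y u, y w⟫_ℝ = G.adjMatrix u w + if u = w then 2 else 0 := fun u w => by
    have hinner : ⟪x u, x w⟫_ℝ = _ := congrFun₂ hx u w
    have hsingle : ⟪Set.indicator {v} (1 : V → ℝ) u, Set.indicator {v} 1 w⟫_ℝ =
        Matrix.single v v 1 u w := by
      by_cases hu : u = v <;> by_cases hw : w = v <;> simp [hu, hw, Matrix.single, Ne.symm]
    rw [WithLp.prod_inner_apply, hsingle, hinner, modAdjMatrix_eq_sub_single, Matrix.add_apply,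
      Matrix.sub_apply, Matrix.smul_apply, Matrix.one_apply, smul_ite, smul_zero, smul_eq_mul,
      mul_one]
    ring
  refine ⟨m, WithLp.toLp 2 (1, 0), y, by simp, fun u => ?_, fun u => ?_, fun u w => ?_,
    fun {u w} huw => ?_, ?_⟩
  · rw [← real_inner_self_eq_norm_sq, hy, adjMatrix_self, if_pos rfl, zero_add]
  · simp [y]
  · rw [hy]
    refine add_mem (G.adjMatrix_mem_int u w) ?_
    split_ifs
    · exact ⟨2, by simp⟩
    · exact zero_mem _
  · rw [hy, if_neg huw, add_zero, ne_eq, adjMatrix_eq_zero_iff, not_not]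
  · exact linearIndependent_option_elim_of_map_eq_zero (WithLp.sndₗ 2 ℝ ℝ _)
      (Matrix.linearIndependent_of_posDef_gram (hx ▸ hpos)) rfl (by simp)

end EdgeSignedGraph

theorem mainTheorem2 {V : Type*} [Fintype V] (G : EdgeSignedGraph V)
    (hconn : G.underlying.Connected) (hG : -2 < smallestEigenvalue G.adjMatrix) (v : V) :
    smallestEigenvalue (G.modAdjMatrix v) < smallestEigenvalue G.adjMatrix ∧
    (-2 < smallestEigenvalue (G.modAdjMatrix v) ↔ G.underlying.IsTreeLineGraphAtEndEdge v) ∧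
    (¬ G.underlying.IsTreeLineGraphAtEndEdge v → smallestEigenvalue (G.modAdjMatrix v) ≤ -2) := by
  have hiff : -2 < smallestEigenvalue (G.modAdjMatrix v) ↔
      G.underlying.IsTreeLineGraphAtEndEdge v := by
    refine ⟨fun hv => ?_,
      fun h => (EdgeSignedGraph.neg_two_lt_and_lt_of_isTreeLineGraphAtEndEdge hG h).1⟩
    obtain ⟨m, e, x, hx⟩ := EdgeSignedGraph.exists_isRootRepresentation hv
    exact hx.isTreeLineGraphAtEndEdge hconn.preconnected
  refine ⟨?_, hiff, fun h => not_lt.1 (mt hiff.1 h)⟩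
  by_cases h : G.underlying.IsTreeLineGraphAtEndEdge v
  · exact (EdgeSignedGraph.neg_two_lt_and_lt_of_isTreeLineGraphAtEndEdge hG h).2
  · exact (not_lt.1 (mt hiff.1 h)).trans_lt hG
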